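/- Consider the three-state chained (nonholonomic) system \[ \dot x_1 = u(t,x),\qquad \dot x_2 = u(t,x)\,x_3,\qquad \dot x_3 = v(t,x),\qquad x=(x_1,x_2,x_3)\in\mathbb{R}^3, \] in closed loop with the feedback \[ v(t,x) = -x_3 - u(t,x)\,x_2,\qquad u(t,x) = -x_1 + h(t,x_{2,3}),\qquad x_{2,3}:=(x_2,x_3), \] where $h:\mathbb{R}\times\mathbb{R}^2\to\mathbb{R}$ is twice continuously differentiable. Assume that (i) $h(t,0)=0$ for all $t\in\mathbb{R}$, and there is a non-decreasing function $\rho:[0,\infty)\to\mathbb{R}$ such that all first and second partial derivatives of $h$ with respect to $t,x_2,x_3$ are bounded in absolute value by $\rho(|x_{2,3}|)$ at every $(t,x_{2,3})\in\mathbb{R}\times\mathbb{R}^2$; (ii) the function $\psi(t,x_2):=\frac{\partial}{\partial t}\,h\bigl(t,(x_2,0)\bigr)$ is uniformly $\delta$-persistently exciting (U$\delta$-PE) with respect to $x_2$: for each $x_2\in\mathbb{R}\setminus\{0\}$ there exist $\delta>0$, $T>0$ and $\mu>0$ such that, for all $t\in\mathbb{R}$ and all $z\in\mathbb{R}$ with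 $|z-x_2|\le\delta$, \[ \int_t^{t+T}|\psi(\tau,z)|\,d\tau\ \ge\ \mu . \] Then the origin of the closed-loop system is uniformly globally asymptotically stable (UGAS). That is, all solutions exist for all forward times, and: (UGS) there is a continuous, strictly increasing, unbounded function $\gamma:[0,\infty)\to[0,\infty)$ with $\gamma(0)=0$ such that for every $(t_\circ,x_\circ)\in\mathbb{R}\times\mathbb{R}^3$ every solution $x(\cdot)$ with $x(t_\circ)=x_\circ$ satisfies $|x(t)|\le\gamma(|x_\circ|)$ for all $t\ge t_\circ$; (UGA) for all $r,\sigma>0$ there is $T>0$ such that for every $(t_\circ,x_\circ)\in\mathbb{R}\times\mathbb{R}^3$ with $|x_\circ|\le r$ every solution $x(\cdot)$ with $x(t_\circ)=x_\circ$ satisfies $|x(t)|\le\sigma$ for all $t\ge t_\circ+T$. -/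

import Mathlib

noncomputable section

namespace ChainedSystem

/-! ### Stability of time-varying systems `x' = f(t, x)` -/

section Stability

variable {E : Type*} [NormedAddCommGroup E] [NormedSpace ℝ E]

/-- `x` solves `x' = f(t, x)`, `x(t₀) = x₀` on the interval `I` (one-sided derivatives at
those end points that belong to `I`). -/
def IsSolutionOn (f : ℝ → E → E) (t₀ : ℝ) (x₀ : E) (I : Set ℝ) (x : ℝ → E) : Prop :=
  x t₀ = x₀ ∧ ∀ t ∈ I, HasDerivWithinAt x (f t (x t)) I t

/-- All solutions exist for all forward times: from every initial condition there is a solution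
on `[t₀, ∞)`, and every solution on a bounded interval `[t₀, b)` is the restriction of a solution
on `[t₀, ∞)` (so there is no finite escape time). -/
def ForwardComplete (f : ℝ → E → E) : Prop :=
  ∀ (t₀ : ℝ) (x₀ : E),
    (∃ x, IsSolutionOn f t₀ x₀ (Set.Ici t₀) x) ∧
    ∀ (b : ℝ) (x : ℝ → E), t₀ < b → IsSolutionOn f t₀ x₀ (Set.Ico t₀ b) x →
      ∃ y, IsSolutionOn f t₀ x₀ (Set.Ici t₀) y ∧ Set.EqOn x y (Set.Ico t₀ b)

/-- Class `K∞`, for functions on `[0, ∞)` (the values on negative numbers are irrelevant). -/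
structure IsClassKInfty (γ : ℝ → ℝ) : Prop where
  continuousOn : ContinuousOn γ (Set.Ici 0)
  strictMonoOn : StrictMonoOn γ (Set.Ici 0)
  map_zero : γ 0 = 0
  tendsto_atTop : Filter.Tendsto γ Filter.atTop Filter.atTop

/-- Uniform global stability of the origin. -/
def UGS (f : ℝ → E → E) : Prop :=
  ForwardComplete f ∧
  ∃ γ : ℝ → ℝ, IsClassKInfty γ ∧
    ∀ (t₀ : ℝ) (x₀ : E) (x : ℝ → E), IsSolutionOn f t₀ x₀ (Set.Ici t₀) x →
      ∀ t, t₀ ≤ t → ‖x t‖ ≤ γ ‖x₀‖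

/-- Uniform global attractivity of the origin. -/
def UGA (f : ℝ → E → E) : Prop :=
  ForwardComplete f ∧
  ∀ r : ℝ, 0 < r → ∀ σ : ℝ, 0 < σ → ∃ T : ℝ, 0 < T ∧
    ∀ (t₀ : ℝ) (x₀ : E) (x : ℝ → E), IsSolutionOn f t₀ x₀ (Set.Ici t₀) x →
      ‖x₀‖ ≤ r → ∀ t, t₀ + T ≤ t → ‖x t‖ ≤ σ

/-- Uniform global asymptotic stability of the origin. -/
def UGAS (f : ℝ → E → E) : Prop :=
  UGS f ∧ UGA f

end Stability

/-! ### Uniform `δ`-persistency of excitation -/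

/-- `φ(t, x)` is uniformly `δ`-persistently exciting with respect to the component `π x` of `x`. -/
def UDeltaPE {E E₁ F : Type*} [NormedAddCommGroup E] [Zero E₁] [NormedAddCommGroup F]
    (φ : ℝ → E → F) (π : E → E₁) : Prop :=
  (∀ x, MeasureTheory.LocallyIntegrable (fun t => φ t x) MeasureTheory.volume) ∧
  ∀ x : E, π x ≠ 0 → ∃ δ : ℝ, 0 < δ ∧ ∃ T : ℝ, 0 < T ∧ ∃ μ : ℝ, 0 < μ ∧
    ∀ (t : ℝ) (z : E), ‖z - x‖ ≤ δ → μ ≤ ∫ τ in t..(t + T), ‖φ τ z‖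

/-! ### The chained system and its feedback

The state is `x = (x₁, x₂, x₃)`, with coordinates `x 0`, `x 1`, `x 2`. -/

/-- The three-state chained system `x₁' = u`, `x₂' = u x₃`, `x₃' = v` under the feedback
laws `u(t, x)`, `v(t, x)`. -/
def chainedField (u v : ℝ → EuclideanSpace ℝ (Fin 3) → ℝ) :
    ℝ → EuclideanSpace ℝ (Fin 3) → EuclideanSpace ℝ (Fin 3) :=
  fun t x => !₂[u t x, u t x * x 2, v t x]

/-- `u(t, x) = -x₁ + h(t, (x₂, x₃))`. -/
def controlU (h : ℝ → EuclideanSpace ℝ (Fin 2) → ℝ) : ℝ → EuclideanSpace ℝ (Fin 3) → ℝ :=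
  fun t x => -x 0 + h t !₂[x 1, x 2]

/-- `v(t, x) = -x₃ - u(t, x) x₂`. -/
def controlV (h : ℝ → EuclideanSpace ℝ (Fin 2) → ℝ) : ℝ → EuclideanSpace ℝ (Fin 3) → ℝ :=
  fun t x => -x 2 - controlU h t x * x 1

/-- The closed-loop vector field. -/
def closedLoop (h : ℝ → EuclideanSpace ℝ (Fin 2) → ℝ) :
    ℝ → EuclideanSpace ℝ (Fin 3) → EuclideanSpace ℝ (Fin 3) :=
  chainedField (controlU h) (controlV h)

/-- The coordinate directions of `t`, `x₂`, `x₃` in the space of `(t, (x₂, x₃))`. -/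
def coordDir : Fin 3 → ℝ × EuclideanSpace ℝ (Fin 2) :=
  ![(1, 0), (0, !₂[1, 0]), (0, !₂[0, 1])]

/-- The partial derivative of `g(t, (x₂, x₃))` in the `i`-th of the variables `t`, `x₂`, `x₃`. -/
def partialDeriv (i : Fin 3) (g : ℝ × EuclideanSpace ℝ (Fin 2) → ℝ) :
    ℝ × EuclideanSpace ℝ (Fin 2) → ℝ :=
  fun p => lineDeriv ℝ g p (coordDir i)

/-- `h₀(t, x₂) = h(t, (x₂, 0))`. -/
def hZero (h : ℝ → EuclideanSpace ℝ (Fin 2) → ℝ) : ℝ → ℝ → ℝ :=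
  fun t x₂ => h t !₂[x₂, 0]

/-- `ψ(t, x₂) = ∂h₀/∂t (t, x₂)`. -/
def psi (h : ℝ → EuclideanSpace ℝ (Fin 2) → ℝ) : ℝ → ℝ → ℝ :=
  fun t x₂ => deriv (fun s => hZero h s x₂) t

end ChainedSystem

end

/-! Put `V = x₂² + x₃²`. The feedback `v` cancels `u` from its derivative: `V' = -2 x₃²` whatever
`u` is. So `|x₂₃|` never exceeds its initial value, hence for `|x₀| ≤ r` one has `|h| ≤ 3 ρ(r) r`,
and `x₁' = -x₁ + h` keeps `|x₁| ≤ r + 3 ρ(r) r`. These a priori bounds (`state_bound`) give forward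
completeness and uniform stability.

For attractivity, `V` must fall below `ε²` within a uniform time (`exists_time_energy_lt`). If it
did not, some window among many of fixed length would see `V` drop by at most a tiny `κ`. A
quantitative Barbalat argument (`exists_forall_deriv_le_of_osc_le`: small oscillation and a
Lipschitz derivative force a small derivative) makes `V'`, hence `x₃`, small there; applied to `x₃`
it makes `x₃'`, hence `u x₂`, small; and `|x₂| ≥ ε/2` then makes `u` small
(`BoundedTraj.exists_small_of_energy_drop_le`). With `u` small, `x₁` and `x₂` hardly move, so `h = u
+ x₁` is nearly constant, and so is `t ↦ h(t, (x₂(s), 0))` with `x₂` frozen at the start `s` of the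
window. A third use of the Barbalat lemma makes `ψ(·, x₂(s))` small on the whole window, against
persistency of excitation.

Once `V` is small, `x₁' = -x₁ + h` has a small input and exponential decay finishes
(`abs_le_exp_decay`). -/

open Set Metric Function MeasureTheory

namespace ChainedSystem

/-! ### Uniqueness, existence and continuation for `C¹` time-varying fields. -/

section ODE

variable {E : Type*} [NormedAddCommGroup E] [NormedSpace ℝ E] [FiniteDimensional ℝ E]

/-- A `C¹` time-varying field is Lipschitz in the state, uniformly on compact time intervals and
on balls. -/
theorem exists_lipschitzOnWith_closedBall {f : ℝ → E → E} (hf : ContDiff ℝ 1 (uncurry f))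
    (a b : ℝ) (c : E) (R : ℝ) :
    ∃ K, ∀ t ∈ Icc a b, LipschitzOnWith K (f t) (closedBall c R) := by
  obtain ⟨K, hK⟩ := (hf.contDiffOn (s := Icc a b ×ˢ closedBall c R)).exists_lipschitzOnWith
    one_ne_zero ((convex_Icc a b).prod (convex_closedBall c R))
    (isCompact_Icc.prod (isCompact_closedBall c R))
  refine ⟨K, fun t ht x hx y hy => ?_⟩
  have := hK (x := (t, x)) ⟨ht, hx⟩ (y := (t, y)) ⟨ht, hy⟩
  simpa [Prod.edist_eq] using this

/-- Both solutions are bounded on the compact interval, so they stay in one ball on which the field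
is uniformly Lipschitz, and Gronwall uniqueness applies. -/
theorem eqOn_Icc_of_hasDerivWithinAt {f : ℝ → E → E} (hf : ContDiff ℝ 1 (uncurry f))
    {a b : ℝ} {x y : ℝ → E}
    (hx : ∀ t ∈ Icc a b, HasDerivWithinAt x (f t (x t)) (Icc a b) t)
    (hy : ∀ t ∈ Icc a b, HasDerivWithinAt y (f t (y t)) (Icc a b) t) (hxy : x a = y a) :
    EqOn x y (Icc a b) := by
  have hxc : ContinuousOn x (Icc a b) := fun t ht => (hx t ht).continuousWithinAt
  have hyc : ContinuousOn y (Icc a b) := fun t ht => (hy t ht).continuousWithinAt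
  obtain ⟨A, hA⟩ := isCompact_Icc.exists_bound_of_continuousOn hxc
  obtain ⟨B, hB⟩ := isCompact_Icc.exists_bound_of_continuousOn hyc
  obtain ⟨K, hK⟩ := exists_lipschitzOnWith_closedBall hf a b 0 (max A B)
  refine ODE_solution_unique_of_mem_Icc_right (v := f) (s := fun _ => closedBall 0 (max A B))
    (fun t ht => hK t (Ico_subset_Icc_self ht)) hxc ?_ ?_ hyc ?_ ?_ hxy
  · exact fun t ht => (hx t (Ico_subset_Icc_self ht)).mono_of_mem_nhdsWithin
      (Icc_mem_nhdsGE_of_mem ht)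
  · exact fun t ht => by simpa using Or.inl (hA t (Ico_subset_Icc_self ht))
  · exact fun t ht => (hy t (Ico_subset_Icc_self ht)).mono_of_mem_nhdsWithin
      (Icc_mem_nhdsGE_of_mem ht)
  · exact fun t ht => by simpa using Or.inr (hB t (Ico_subset_Icc_self ht))

/-- A bounded `C¹` field has solutions on every compact interval. -/
theorem exists_hasDerivWithinAt_Icc_of_bounded {f : ℝ → E → E} (hf : ContDiff ℝ 1 (uncurry f))
    {a b : ℝ} (hab : a ≤ b) (x₀ : E) {L : ℝ} (hL : ∀ t ∈ Icc a b, ∀ x, ‖f t x‖ ≤ L) :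
    ∃ y : ℝ → E, y a = x₀ ∧ ∀ t ∈ Icc a b, HasDerivWithinAt y (f t (y t)) (Icc a b) t := by
  have hL0 : 0 ≤ L := (norm_nonneg _).trans (hL a ⟨le_rfl, hab⟩ 0)
  lift L to NNReal using hL0
  let R : NNReal := ⟨L * (b - a), mul_nonneg L.2 (sub_nonneg.2 hab)⟩
  obtain ⟨K, hK⟩ := exists_lipschitzOnWith_closedBall hf a b x₀ R
  have hP : IsPicardLindelof f (⟨a, le_rfl, hab⟩ : Icc a b) x₀ R 0 L K :=
    { lipschitzOnWith := hK
      continuousOn := fun x _ =>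
        (hf.continuous.comp (Continuous.prodMk continuous_id continuous_const)).continuousOn
      norm_le := fun t ht x _ => hL t ht x
      mul_max_le := by
        have hRL : (R : ℝ) = L * (b - a) := rfl
        simp [hab, hRL] }
  exact hP.exists_eq_forall_mem_Icc_hasDerivWithinAt₀

/-- If all solutions of the systems `y' = c(t) f(t, y)`, `c ≥ 0`, obey a common bound, then
`y' = f(t, y)` has a solution on the whole interval. -/
theorem exists_hasDerivWithinAt_Icc_of_apriori {f : ℝ → E → E} (hf : ContDiff ℝ 1 (uncurry f))
    {a b : ℝ} (hab : a ≤ b) (x₀ : E) {R : ℝ}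
    (hR : ∀ (c : ℝ → ℝ) (y : ℝ → E), (∀ t, 0 ≤ c t) → y a = x₀ →
      (∀ t ∈ Icc a b, HasDerivWithinAt y (c t • f t (y t)) (Icc a b) t) →
      ∀ t ∈ Icc a b, ‖y t‖ ≤ R) :
    ∃ y : ℝ → E, y a = x₀ ∧ ∀ t ∈ Icc a b, HasDerivWithinAt y (f t (y t)) (Icc a b) t := by
  have hpos : 0 < |R| + 1 := by positivity
  -- The truncated field `χ • f` is bounded, so it has a solution `y`. That solution obeys `y' =
  -- c(t) f(t, y)` with `c(t) = χ(y(t)) ≥ 0`, so the a priori bound keeps it where `χ = 1`, and it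
  -- solves the original equation.
  let χ : ContDiffBump (0 : E) := ⟨|R| + 1, |R| + 2, hpos, by linarith⟩
  have hg : ContDiff ℝ 1 (uncurry fun t x => χ x • f t x) :=
    (χ.contDiff.comp contDiff_snd).smul hf
  obtain ⟨L, hL⟩ := (isCompact_Icc.prod (isCompact_closedBall (0 : E) (|R| + 2))).exists_bound_of_continuousOn
    (hg.continuous.continuousOn (s := Icc a b ×ˢ closedBall (0 : E) (|R| + 2)))
  have hL0 : 0 ≤ L := (norm_nonneg _).trans (hL (a, 0) ⟨⟨le_rfl, hab⟩, by simp; positivity⟩)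
  obtain ⟨y, hy0, hy⟩ := exists_hasDerivWithinAt_Icc_of_bounded hg hab x₀ (L := L) (by
    intro t ht x
    by_cases hx : x ∈ closedBall (0 : E) (|R| + 2)
    · exact hL (t, x) ⟨ht, hx⟩
    · have : χ x = 0 := χ.zero_of_le_dist (by simpa [χ] using (not_le.1 (fun h => hx (by simpa using h))).le)
      simpa [this] using hL0)
  refine ⟨y, hy0, fun t ht => ?_⟩
  have hb := hR (fun t => χ (y t)) y (fun t => χ.nonneg) hy0 hy t ht
  have h1 : χ (y t) = 1 := χ.one_of_mem_closedBall (by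
    simp only [χ, mem_closedBall, dist_zero_right]
    linarith [le_abs_self R])
  simpa [h1] using hy t ht

theorem forwardComplete_of_apriori {f : ℝ → E → E} (hf : ContDiff ℝ 1 (uncurry f))
    (hR : ∀ (a : ℝ) (x₀ : E), ∃ R, ∀ (b : ℝ) (c : ℝ → ℝ) (y : ℝ → E), (∀ t, 0 ≤ c t) →
      y a = x₀ → (∀ t ∈ Icc a b, HasDerivWithinAt y (c t • f t (y t)) (Icc a b) t) →
      ∀ t ∈ Icc a b, ‖y t‖ ≤ R) :
    ForwardComplete f := by
  intro a x₀
  obtain ⟨R, hR⟩ := hR a x₀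
  have hex : ∀ n : ℕ, ∃ y : ℝ → E, y a = x₀ ∧
      ∀ t ∈ Icc a (a + n), HasDerivWithinAt y (f t (y t)) (Icc a (a + n)) t := fun n =>
    exists_hasDerivWithinAt_Icc_of_apriori hf (by simp) x₀ (hR (a + n))
  choose y hy0 hy using hex
  have hmono : ∀ {b c : ℝ} {x : ℝ → E}, b ≤ c →
      (∀ t ∈ Icc a c, HasDerivWithinAt x (f t (x t)) (Icc a c) t) →
      ∀ t ∈ Icc a b, HasDerivWithinAt x (f t (x t)) (Icc a b) t := fun hbc h t ht =>
    (h t ⟨ht.1, ht.2.trans hbc⟩).mono (Icc_subset_Icc_right hbc)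
  have heq : ∀ m n : ℕ, ∀ t ∈ Icc a (a + m), t ≤ a + n → y m t = y n t := by
    intro m n t ht htn
    refine eqOn_Icc_of_hasDerivWithinAt hf (b := t) (hmono ht.2 (hy m)) (hmono htn (hy n))
      ((hy0 m).trans (hy0 n).symm) ⟨ht.1, le_rfl⟩
  -- By uniqueness the solutions on `[a, a + n]` agree on overlaps, so any `n ≥ t - a` may serve at
  -- time `t`.
  let z : ℝ → E := fun t => y (⌈t - a⌉₊) t
  have hz : ∀ n : ℕ, EqOn z (y n) (Icc a (a + n)) := fun n t ht =>
    heq _ n t ⟨ht.1, by linarith [Nat.le_ceil (t - a)]⟩ ht.2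
  have hzsol : IsSolutionOn f a x₀ (Ici a) z := by
    refine ⟨by simp [z, hy0], fun t ht => ?_⟩
    have ht' : a ≤ t := ht
    obtain ⟨n, hn⟩ := exists_nat_gt (t - a)
    have hmem : t ∈ Icc a (a + n) := ⟨ht, by linarith⟩
    have h1 := ((hy n) t hmem).congr (hz n) (hz n hmem)
    rw [← hz n hmem] at h1
    refine h1.mono_of_mem_nhdsWithin ?_
    have : Icc a (a + n) = Ici a ∩ Iic (a + n) := rfl
    rw [this]
    exact Filter.inter_mem self_mem_nhdsWithin
      (mem_nhdsWithin_of_mem_nhds (Iic_mem_nhds (by linarith)))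
  refine ⟨⟨z, hzsol⟩, fun b x hab hx => ⟨z, hzsol, fun t ht => ?_⟩⟩
  refine eqOn_Icc_of_hasDerivWithinAt hf (b := t) (fun s hs => ?_) (fun s hs => ?_)
    (hx.1.trans hzsol.1.symm) ⟨ht.1, le_rfl⟩
  · exact (hx.2 s ⟨hs.1, hs.2.trans_lt ht.2⟩).mono fun r hr => ⟨hr.1, hr.2.trans_lt ht.2⟩
  · exact (hzsol.2 s hs.1).mono Icc_subset_Ici_self

end ODE

/-! ### Norms of planar vectors. -/

section Coordinates

theorem norm_vec2_le (a b : ℝ) : ‖(!₂[a, b] : EuclideanSpace ℝ (Fin 2))‖ ≤ |a| + |b| := by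
  refine abs_le_of_sq_le_sq' ?_ (by positivity) |>.2
  rw [EuclideanSpace.real_norm_sq_eq]
  simp only [Fin.sum_univ_two, Matrix.cons_val_zero, Matrix.cons_val_one]
  nlinarith [sq_abs a, sq_abs b, mul_nonneg (abs_nonneg a) (abs_nonneg b)]

theorem norm_vec2_sub_le (a b c d : ℝ) :
    ‖(!₂[a, b] : EuclideanSpace ℝ (Fin 2)) - !₂[c, d]‖ ≤ |a - c| + |b - d| := by
  have : (!₂[a, b] : EuclideanSpace ℝ (Fin 2)) - !₂[c, d] = !₂[a - c, b - d] := by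
    ext i; fin_cases i <;> simp
  rw [this]
  exact norm_vec2_le _ _

theorem norm_vec2_sq (a b : ℝ) : ‖(!₂[a, b] : EuclideanSpace ℝ (Fin 2))‖ ^ 2 = a ^ 2 + b ^ 2 := by
  simp [EuclideanSpace.real_norm_sq_eq]

theorem norm_vec2_zero (a : ℝ) : ‖(!₂[a, 0] : EuclideanSpace ℝ (Fin 2))‖ = |a| := by
  rw [← sq_eq_sq₀ (norm_nonneg _) (abs_nonneg _), norm_vec2_sq]
  simp

end Coordinates

/-! ### Bounds on `h` and `ψ` from the partial derivatives. -/

section Feedback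

variable {H : ℝ × EuclideanSpace ℝ (Fin 2) → ℝ}

theorem partialDeriv_eq_fderiv {p : ℝ × EuclideanSpace ℝ (Fin 2)} (hH : DifferentiableAt ℝ H p)
    (i : Fin 3) : partialDeriv i H p = fderiv ℝ H p (coordDir i) :=
  hH.lineDeriv_eq_fderiv

/-- Each of the three coordinates of a vector is at most its norm; this is the source of every later
factor `3 * ρ`. -/
theorem norm_fderiv_le_of_partialDeriv {p : ℝ × EuclideanSpace ℝ (Fin 2)}
    (hH : DifferentiableAt ℝ H p) {B : ℝ} (hB : ∀ i, |partialDeriv i H p| ≤ B) :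
    ‖fderiv ℝ H p‖ ≤ 3 * B := by
  have hB0 : 0 ≤ B := (abs_nonneg _).trans (hB 0)
  refine ContinuousLinearMap.opNorm_le_bound _ (by positivity) fun v => ?_
  have hv : v = v.1 • coordDir 0 + v.2 0 • coordDir 1 + v.2 1 • coordDir 2 := by
    refine Prod.ext ?_ ?_
    · simp [coordDir]
    · ext i; fin_cases i <;> simp [coordDir]
  have h0 := hB 0
  have h1 := hB 1
  have h2 := hB 2
  rw [partialDeriv_eq_fderiv hH] at h0 h1 h2
  have n0 : ‖v.1‖ ≤ ‖v‖ := norm_fst_le v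
  have n1 : ‖v.2 0‖ ≤ ‖v‖ := (PiLp.norm_apply_le v.2 0).trans (norm_snd_le v)
  have n2 : ‖v.2 1‖ ≤ ‖v‖ := (PiLp.norm_apply_le v.2 1).trans (norm_snd_le v)
  calc ‖fderiv ℝ H p v‖
      = ‖v.1 * fderiv ℝ H p (coordDir 0) + v.2 0 * fderiv ℝ H p (coordDir 1)
          + v.2 1 * fderiv ℝ H p (coordDir 2)‖ := by
        conv_lhs => rw [hv]
        simp only [map_add, map_smul, smul_eq_mul]
    _ ≤ ‖v.1‖ * B + ‖v.2 0‖ * B + ‖v.2 1‖ * B := by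
        refine (norm_add₃_le).trans ?_
        simp only [norm_mul]
        gcongr <;> assumption
    _ ≤ ‖v‖ * B + ‖v‖ * B + ‖v‖ * B := by gcongr
    _ = 3 * B * ‖v‖ := by ring

variable {h : ℝ → EuclideanSpace ℝ (Fin 2) → ℝ} {ρ : ℝ → ℝ}

theorem abs_sub_le_of_partialDeriv_le (h_smooth : ContDiff ℝ 2 (uncurry h))
    (hρ : MonotoneOn ρ (Ici 0))
    (h_first : ∀ (i : Fin 3) (t : ℝ) (z : EuclideanSpace ℝ (Fin 2)),
      |partialDeriv i (uncurry h) (t, z)| ≤ ρ ‖z‖) {R : ℝ}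
    {z w : EuclideanSpace ℝ (Fin 2)} (hz : ‖z‖ ≤ R) (hw : ‖w‖ ≤ R) (t s : ℝ) :
    |h t z - h s w| ≤ 3 * ρ R * (|t - s| + ‖z - w‖) := by
  have hd : Differentiable ℝ (uncurry h) := h_smooth.differentiable (by norm_num)
  have hρ0 : 0 ≤ ρ R := ((abs_nonneg _).trans (h_first 0 0 z)).trans
    (hρ (norm_nonneg z) ((norm_nonneg z).trans hz) hz)
  have key := ((convex_univ (𝕜 := ℝ) (E := ℝ)).prod
    (convex_closedBall (0 : EuclideanSpace ℝ (Fin 2)) R)).norm_image_sub_le_of_norm_fderiv_le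
    (𝕜 := ℝ) (f := uncurry h) (C := 3 * ρ R) (x := (s, w)) (y := (t, z)) (fun p _ => hd p)
    (fun p hp => ?_) ⟨mem_univ _, by simpa using hw⟩ ⟨mem_univ _, by simpa using hz⟩
  · refine key.trans ?_
    gcongr
    rw [Prod.mk_sub_mk, Prod.norm_mk]
    exact max_le (le_add_of_nonneg_right (norm_nonneg _)) (le_add_of_nonneg_left (abs_nonneg _))
  · have hp2 : ‖p.2‖ ≤ R := by simpa using hp.2
    refine norm_fderiv_le_of_partialDeriv (hd p) fun i => (h_first i p.1 p.2).trans ?_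
    exact hρ (norm_nonneg _) ((norm_nonneg _).trans hp2) hp2

theorem abs_le_of_partialDeriv_le (h_smooth : ContDiff ℝ 2 (uncurry h))
    (h_zero : ∀ t : ℝ, h t 0 = 0) (hρ : MonotoneOn ρ (Ici 0))
    (h_first : ∀ (i : Fin 3) (t : ℝ) (z : EuclideanSpace ℝ (Fin 2)),
      |partialDeriv i (uncurry h) (t, z)| ≤ ρ ‖z‖) {R : ℝ}
    {z : EuclideanSpace ℝ (Fin 2)} (hz : ‖z‖ ≤ R) (t : ℝ) : |h t z| ≤ 3 * ρ R * ‖z‖ := by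
  simpa [h_zero] using abs_sub_le_of_partialDeriv_le h_smooth hρ h_first hz
    (w := 0) (by simpa using (norm_nonneg z).trans hz) t t

theorem hasDerivAt_prodMk_const (t : ℝ) (z : EuclideanSpace ℝ (Fin 2)) :
    HasDerivAt (fun s : ℝ => (s, z)) (coordDir 0) t :=
  (hasDerivAt_id t).prodMk (hasDerivAt_const t z)

theorem hasDerivAt_partialDeriv_zero {t : ℝ} {z : EuclideanSpace ℝ (Fin 2)}
    (hH : DifferentiableAt ℝ H (t, z)) :
    HasDerivAt (fun s => H (s, z)) (partialDeriv 0 H (t, z)) t := by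
  rw [partialDeriv_eq_fderiv hH]
  exact hH.hasFDerivAt.comp_hasDerivAt t (hasDerivAt_prodMk_const t z)

theorem psi_eq_partialDeriv (h_smooth : ContDiff ℝ 2 (uncurry h)) (t x : ℝ) :
    psi h t x = partialDeriv 0 (uncurry h) (t, !₂[x, 0]) :=
  (hasDerivAt_partialDeriv_zero (h_smooth.differentiable (by norm_num) (t, !₂[x, 0]))).deriv

theorem hasDerivAt_hZero (h_smooth : ContDiff ℝ 2 (uncurry h)) (t x : ℝ) :
    HasDerivAt (fun s => hZero h s x) (psi h t x) t := by
  rw [psi_eq_partialDeriv h_smooth]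
  exact hasDerivAt_partialDeriv_zero (h_smooth.differentiable (by norm_num) (t, !₂[x, 0]))

theorem abs_psi_sub_le (h_smooth : ContDiff ℝ 2 (uncurry h))
    (h_second : ∀ (i j : Fin 3) (t : ℝ) (z : EuclideanSpace ℝ (Fin 2)),
      |partialDeriv i (partialDeriv j (uncurry h)) (t, z)| ≤ ρ ‖z‖) (t s x : ℝ) :
    |psi h t x - psi h s x| ≤ ρ |x| * |t - s| := by
  have hd : Differentiable ℝ (uncurry h) := h_smooth.differentiable (by norm_num)
  have heq : partialDeriv 0 (uncurry h) = fun p => fderiv ℝ (uncurry h) p (coordDir 0) :=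
    funext fun p => partialDeriv_eq_fderiv (hd p) 0
  have hd' : Differentiable ℝ (partialDeriv 0 (uncurry h)) := by
    rw [heq]
    exact ((h_smooth.fderiv_right (m := 1) (by norm_num)).differentiable (by norm_num)).clm_apply
      (differentiable_const _)
  rw [psi_eq_partialDeriv h_smooth, psi_eq_partialDeriv h_smooth]
  refine (convex_univ (𝕜 := ℝ) (E := ℝ)).norm_image_sub_le_of_norm_hasDerivWithin_le
    (f := fun s => partialDeriv 0 (uncurry h) (s, !₂[x, 0]))
    (fun r _ => (hasDerivAt_partialDeriv_zero (hd' (r, !₂[x, 0]))).hasDerivWithinAt)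
    (fun r _ => ?_) (mem_univ s) (mem_univ t)
  rw [← norm_vec2_zero x]
  exact h_second 0 0 r _

end Feedback

/-! ### Barbalat-type estimate, monotonicity, barriers, compactness of excitation. -/

section RealLemmas

/-- If `g` has small oscillation on an interval of length at least one and `g'` is Lipschitz with a
known constant, then `g'` is small. -/
theorem exists_forall_deriv_le_of_osc_le {M κ : ℝ} (hM : 0 ≤ M) (hκ : 0 < κ) :
    ∃ κ' : ℝ, 0 < κ' ∧ ∀ (a b : ℝ) (g g' : ℝ → ℝ), 1 ≤ b - a →
      (∀ t ∈ Icc a b, HasDerivWithinAt g (g' t) (Icc a b) t) →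
      (∀ t ∈ Icc a b, ∀ s ∈ Icc a b, |g' t - g' s| ≤ M * |t - s|) →
      (∀ t ∈ Icc a b, ∀ s ∈ Icc a b, |g t - g s| ≤ κ') → ∀ t ∈ Icc a b, |g' t| ≤ κ := by
  -- The step `d` is at most `1/2`, so `t + d` or `t - d` stays in an interval of length at least
  -- one, and `g'` varies by at most `κ/2` over it. An oscillation of at most `κ/2 * d` makes the
  -- mean slope at most `κ/2`.
  let d : ℝ := min (1 / 2) (κ / (2 * (M + 1)))
  have hd : 0 < d := lt_min (by norm_num) (by positivity)
  have hd1 : d ≤ 1 / 2 := min_le_left _ _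
  have hdM : M * d ≤ κ / 2 := by
    have h1 : d ≤ κ / (2 * (M + 1)) := min_le_right _ _
    rw [le_div_iff₀ (by positivity)] at h1
    nlinarith
  refine ⟨κ / 2 * d, by positivity, fun a b g g' hab hg hlip hosc t ht => ?_⟩
  have step : ∀ p q : ℝ, a ≤ p → q ≤ b → q = p + d → (p = t ∨ q = t) → |g' t| ≤ κ := by
    intro p q hp hq hpq hor
    have hlt : p < q := by linarith
    have hsub : Icc p q ⊆ Icc a b := Icc_subset_Icc hp hq
    obtain ⟨ξ, hξ, hξe⟩ := exists_hasDerivAt_eq_slope g g' hlt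
      (fun r hr => ((hg r (hsub hr)).continuousWithinAt).mono hsub)
      (fun r hr => (hg r (hsub (Ioo_subset_Icc_self hr))).hasDerivAt
        (Icc_mem_nhds (hp.trans_lt hr.1) (hr.2.trans_le hq)))
    have h1 : |g' ξ| ≤ κ / 2 := by
      rw [hξe, abs_div, abs_of_pos (sub_pos.2 hlt), div_le_iff₀ (sub_pos.2 hlt)]
      have := hosc q (hsub ⟨hlt.le, le_rfl⟩) p (hsub ⟨le_rfl, hlt.le⟩)
      rwa [show q - p = d by linarith]
    have h2 : |t - ξ| ≤ d := by
      rw [abs_le]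
      rcases hor with h | h <;> constructor <;> linarith [hξ.1, hξ.2]
    have h3 := hlip t ht ξ (hsub (Ioo_subset_Icc_self hξ))
    have h4 : M * |t - ξ| ≤ M * d := by gcongr
    have h5 : |g' t| ≤ |g' t - g' ξ| + |g' ξ| := by simpa using abs_add_le (g' t - g' ξ) (g' ξ)
    linarith
  by_cases hcase : t + d ≤ b
  · exact step t (t + d) ht.1 hcase rfl (Or.inl rfl)
  · exact step (t - d) t (by linarith) ht.2 (by ring) (Or.inr rfl)

/-- A nonnegative function that starts below `N κ` decreases by at most `κ` over one of `N`
consecutive intervals. -/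
theorem exists_window_drop_le {V : ℝ → ℝ} {a l κ : ℝ} {N : ℕ} (hN : 0 < N)
    (h0 : V a ≤ N * κ) (h1 : 0 ≤ V (a + N * l)) :
    ∃ k < N, V (a + k * l) - V (a + (k + 1 : ℕ) * l) ≤ κ := by
  by_contra! hcon
  have hsum : ∑ k ∈ Finset.range N, κ <
      ∑ k ∈ Finset.range N, (V (a + k * l) - V (a + (k + 1 : ℕ) * l)) :=
    Finset.sum_lt_sum_of_nonempty ⟨0, by simpa using hN⟩
      fun k hk => hcon k (Finset.mem_range.1 hk)
  rw [Finset.sum_range_sub' (fun k : ℕ => V (a + k * l))] at hsum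
  simp at hsum
  linarith

theorem abs_sub_le_of_hasDerivWithinAt_Icc {a b C : ℝ} {g g' : ℝ → ℝ}
    (hg : ∀ t ∈ Icc a b, HasDerivWithinAt g (g' t) (Icc a b) t)
    (hC : ∀ t ∈ Icc a b, |g' t| ≤ C) {t s : ℝ} (ht : t ∈ Icc a b) (hs : s ∈ Icc a b) :
    |g t - g s| ≤ C * |t - s| :=
  (convex_Icc a b).norm_image_sub_le_of_norm_hasDerivWithin_le hg hC hs ht

theorem antitoneOn_Icc_of_hasDerivWithinAt {a b : ℝ} {g g' : ℝ → ℝ}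
    (hg : ∀ t ∈ Icc a b, HasDerivWithinAt g (g' t) (Icc a b) t)
    (hC : ∀ t ∈ Icc a b, g' t ≤ 0) : AntitoneOn g (Icc a b) :=
  antitoneOn_of_hasDerivWithinAt_nonpos (convex_Icc a b)
    (fun t ht => (hg t ht).continuousWithinAt)
    (fun t ht => (hg t (interior_subset ht)).mono interior_subset)
    (fun t ht => hC t (interior_subset ht))

/-- The comparison theorem wants a strict inequality of slopes at contact, so `B` is replaced by a
line of small positive slope lying strictly above it; the slack `ε` then tends to zero. -/
theorem le_of_hasDerivWithinAt_nonpos_above {a b B : ℝ} {g g' : ℝ → ℝ}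
    (hg : ∀ t ∈ Icc a b, HasDerivWithinAt g (g' t) (Icc a b) t) (ha : g a ≤ B)
    (hB : ∀ t ∈ Icc a b, B < g t → g' t ≤ 0) : ∀ t ∈ Icc a b, g t ≤ B := by
  intro t ht
  refine le_of_forall_pos_le_add fun ε hε => ?_
  have hpos : 0 < t - a + 1 := by linarith [ht.1]
  have key := image_le_of_deriv_right_lt_deriv_boundary (f := g) (f' := g') (a := a) (b := t)
    (B := fun s => B + ε / (t - a + 1) * (s - a + 1)) (B' := fun _ => ε / (t - a + 1))
    (fun s hs => ((hg s ⟨hs.1, hs.2.trans ht.2⟩).continuousWithinAt).mono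
      (Icc_subset_Icc_right ht.2))
    (fun s hs => (hg s ⟨hs.1, hs.2.le.trans ht.2⟩).mono_of_mem_nhdsWithin
      (Icc_mem_nhdsGE_of_mem ⟨hs.1, hs.2.trans_le ht.2⟩))
    (by simp only [sub_self, zero_add, mul_one]; have : 0 < ε / (t - a + 1) := by positivity
        linarith)
    (fun s => by
      have := ((((hasDerivAt_id s).sub_const a).add_const 1).const_mul (ε / (t - a + 1))).const_add B
      simpa using this)
    (fun s hs heq => by
      have h1 : 0 < ε / (t - a + 1) := by positivity
      have h2 : 0 < s - a + 1 := by linarith [hs.1]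
      have h3 : 0 < ε / (t - a + 1) * (s - a + 1) := by positivity
      exact (hB s ⟨hs.1, hs.2.le.trans ht.2⟩ (by rw [heq]; linarith)).trans_lt h1)
    ⟨ht.1, le_rfl⟩
  have : ε / (t - a + 1) * (t - a + 1) = ε := by field_simp
  simpa [this] using key

/-- Uniform `δ`-persistency of excitation is uniform on compact sets that avoid `0`. -/
theorem UDeltaPE.exists_forall_isCompact {ψ : ℝ → ℝ → ℝ} (hψ : UDeltaPE ψ fun x : ℝ => x)
    {K : Set ℝ} (hK : IsCompact K) (h0 : (0 : ℝ) ∉ K) :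
    ∃ T : ℝ, 1 ≤ T ∧ ∃ μ : ℝ, 0 < μ ∧ ∀ t : ℝ, ∀ z ∈ K, μ ≤ ∫ τ in t..(t + T), |ψ τ z| := by
  have hmono : ∀ (z t : ℝ) {T T' : ℝ}, 0 ≤ T → T ≤ T' →
      ∫ τ in t..(t + T), |ψ τ z| ≤ ∫ τ in t..(t + T'), |ψ τ z| := fun z t T T' hT hTT =>
    intervalIntegral.integral_mono_interval le_rfl (by linarith) (by linarith)
      (Filter.Eventually.of_forall fun _ => abs_nonneg _)
      (((hψ.1 z).integrableOn_isCompact isCompact_uIcc).intervalIntegrable.norm)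
  revert h0
  -- Finitely many balls cover `K`. The largest `T` and the least `μ` serve for all of them, since
  -- the integral of `|ψ|` grows with `T`. The requirement `1 ≤ T` makes the windows long enough for
  -- the Barbalat lemma.
  refine hK.induction_on (p := fun S => (0 : ℝ) ∉ K → ∃ T : ℝ, 1 ≤ T ∧ ∃ μ : ℝ, 0 < μ ∧
    ∀ t : ℝ, ∀ z ∈ S, μ ≤ ∫ τ in t..(t + T), |ψ τ z|) ?_ ?_ ?_ ?_
  · exact fun _ => ⟨1, le_rfl, 1, one_pos, by simp⟩
  · intro S S' hS h h0
    obtain ⟨T, hT, μ, hμ, h⟩ := h h0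
    exact ⟨T, hT, μ, hμ, fun t z hz => h t z (hS hz)⟩
  · intro S S' h h' h0
    obtain ⟨T, hT, μ, hμ, h⟩ := h h0
    obtain ⟨T', hT', μ', hμ', h'⟩ := h' h0
    refine ⟨max T T', hT.trans (le_max_left _ _), min μ μ', lt_min hμ hμ', fun t z hz => ?_⟩
    rcases hz with hz | hz
    · exact (min_le_left _ _).trans ((h t z hz).trans
        (hmono z t (by linarith) (le_max_left _ _)))
    · exact (min_le_right _ _).trans ((h' t z hz).trans
        (hmono z t (by linarith) (le_max_right _ _)))
  · intro x hx
    by_cases h0 : (0 : ℝ) ∈ K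
    · exact ⟨univ, Filter.univ_mem, fun h => absurd h0 h⟩
    obtain ⟨δ, hδ, T, hT, μ, hμ, h⟩ := hψ.2 x (fun hx0 => h0 (hx0 ▸ hx))
    refine ⟨closedBall x δ, mem_nhdsWithin_of_mem_nhds (closedBall_mem_nhds x hδ), fun _ =>
      ⟨max T 1, le_max_right _ _, μ, hμ, fun t z hz => ?_⟩⟩
    exact (h t z (by simpa [dist_eq_norm] using hz)).trans (hmono z t hT.le (le_max_left _ _))

end RealLemmas

/-! ### Windows of small energy drop, and the contradiction with excitation. -/

section Windows

/-- On `[a, b]`, the functions `x₁, x₂, x₃` satisfy `x₁' = u`, `x₂' = u x₃`, `x₃' = -x₃ - u x₂`,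
with `x₂, x₃, u` bounded by `M` and `u` Lipschitz with constant `M`. -/
structure BoundedTraj (M a b : ℝ) (x₁ x₂ x₃ u : ℝ → ℝ) : Prop where
  deriv₁ : ∀ t ∈ Icc a b, HasDerivWithinAt x₁ (u t) (Icc a b) t
  deriv₂ : ∀ t ∈ Icc a b, HasDerivWithinAt x₂ (u t * x₃ t) (Icc a b) t
  deriv₃ : ∀ t ∈ Icc a b, HasDerivWithinAt x₃ (-x₃ t - u t * x₂ t) (Icc a b) t
  bound₂ : ∀ t ∈ Icc a b, |x₂ t| ≤ M
  bound₃ : ∀ t ∈ Icc a b, |x₃ t| ≤ M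
  bound_u : ∀ t ∈ Icc a b, |u t| ≤ M
  lip_u : ∀ t ∈ Icc a b, ∀ s ∈ Icc a b, |u t - u s| ≤ M * |t - s|

namespace BoundedTraj

variable {M a b : ℝ} {x₁ x₂ x₃ u : ℝ → ℝ}

theorem mono (h : BoundedTraj M a b x₁ x₂ x₃ u) {c d : ℝ} (hac : a ≤ c) (hdb : d ≤ b) :
    BoundedTraj M c d x₁ x₂ x₃ u := by
  have hs : Icc c d ⊆ Icc a b := Icc_subset_Icc hac hdb
  exact ⟨fun t ht => (h.deriv₁ t (hs ht)).mono hs, fun t ht => (h.deriv₂ t (hs ht)).mono hs,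
    fun t ht => (h.deriv₃ t (hs ht)).mono hs, fun t ht => h.bound₂ t (hs ht),
    fun t ht => h.bound₃ t (hs ht), fun t ht => h.bound_u t (hs ht),
    fun t ht s hs' => h.lip_u t (hs ht) s (hs hs')⟩

theorem hasDerivWithinAt_energy (h : BoundedTraj M a b x₁ x₂ x₃ u) (t : ℝ) (ht : t ∈ Icc a b) :
    HasDerivWithinAt (fun t => x₂ t ^ 2 + x₃ t ^ 2) (-2 * x₃ t ^ 2) (Icc a b) t := by
  refine (((h.deriv₂ t ht).pow 2).add ((h.deriv₃ t ht).pow 2)).congr_deriv ?_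
  push_cast
  ring

theorem antitoneOn_energy (h : BoundedTraj M a b x₁ x₂ x₃ u) :
    AntitoneOn (fun t => x₂ t ^ 2 + x₃ t ^ 2) (Icc a b) :=
  antitoneOn_Icc_of_hasDerivWithinAt h.hasDerivWithinAt_energy
    fun t _ => by nlinarith [sq_nonneg (x₃ t)]

theorem lip₂ (h : BoundedTraj M a b x₁ x₂ x₃ u) (hM : 0 ≤ M) {t s : ℝ} (ht : t ∈ Icc a b)
    (hs : s ∈ Icc a b) : |x₂ t - x₂ s| ≤ M * M * |t - s| :=
  abs_sub_le_of_hasDerivWithinAt_Icc h.deriv₂ (fun r hr => by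
    rw [abs_mul]
    gcongr
    exacts [h.bound_u r hr, h.bound₃ r hr]) ht hs

theorem lip₃ (h : BoundedTraj M a b x₁ x₂ x₃ u) (hM : 0 ≤ M) {t s : ℝ} (ht : t ∈ Icc a b)
    (hs : s ∈ Icc a b) : |x₃ t - x₃ s| ≤ (M + M * M) * |t - s| :=
  abs_sub_le_of_hasDerivWithinAt_Icc h.deriv₃ (fun r hr => by
    refine (abs_sub _ _).trans ?_
    rw [abs_neg, abs_mul]
    gcongr
    exacts [h.bound₃ r hr, h.bound_u r hr, h.bound₂ r hr]) ht hs

theorem abs_mul_sub_mul_le {p q p' q' A B P Q : ℝ} (hp : |p| ≤ A) (hq : |q'| ≤ B)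
    (hP : |p - p'| ≤ P) (hQ : |q - q'| ≤ Q) : |p * q - p' * q'| ≤ A * Q + P * B := by
  have hA : 0 ≤ A := (abs_nonneg _).trans hp
  have hP0 : 0 ≤ P := (abs_nonneg _).trans hP
  rw [show p * q - p' * q' = p * (q - q') + (p - p') * q' by ring]
  refine (abs_add_le _ _).trans ?_
  rw [abs_mul, abs_mul]
  gcongr

/-- If the energy hardly decreases over an interval of length at least one, then `x₃` and the
input `u` are small there. -/
theorem exists_small_of_energy_drop_le (hM : 0 < M) {ε ν : ℝ} (hε : 0 < ε) (hν : 0 < ν) :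
    ∃ κ : ℝ, 0 < κ ∧ ∀ (a b : ℝ) (x₁ x₂ x₃ u : ℝ → ℝ), BoundedTraj M a b x₁ x₂ x₃ u →
      1 ≤ b - a → (∀ t ∈ Icc a b, ε ^ 2 ≤ x₂ t ^ 2 + x₃ t ^ 2) →
      (x₂ a ^ 2 + x₃ a ^ 2) - (x₂ b ^ 2 + x₃ b ^ 2) ≤ κ →
      ∀ t ∈ Icc a b, |x₃ t| ≤ ν ∧ |u t| ≤ ν ∧ ε / 2 ≤ |x₂ t| := by
  -- A Lipschitz constant for `x₃' = -x₃ - u x₂`: the first two terms come from `x₃`, the bracket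
  -- from the product `u x₂`.
  let M₃ : ℝ := M + M * M + (M * (M * M) + M * M)
  obtain ⟨κ₁, hκ₁, H₁⟩ := exists_forall_deriv_le_of_osc_le (M := M₃) (κ := ν * ε / 4)
    (by positivity) (by positivity)
  -- The target bound on `|x₃|`: `κ₁/2` limits its oscillation to `κ₁`, `ν ε/4` adds to the bound on
  -- `|x₃'|` to give `|u x₂| ≤ ν ε/2`, `ν` is the bound claimed, and `ε/2` leaves `x₂² ≥ 3ε²/4`.
  let η : ℝ := min (min (κ₁ / 2) (ν * ε / 4)) (min ν (ε / 2))
  have hη : 0 < η := lt_min (lt_min (by positivity) (by positivity))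
    (lt_min hν (by positivity))
  have hη1 : η ≤ κ₁ / 2 := (min_le_left _ _).trans (min_le_left _ _)
  have hη2 : η ≤ ν * ε / 4 := (min_le_left _ _).trans (min_le_right _ _)
  have hη3 : η ≤ ν := (min_le_right _ _).trans (min_le_left _ _)
  have hη4 : η ≤ ε / 2 := (min_le_right _ _).trans (min_le_right _ _)
  obtain ⟨κ, hκ, H₂⟩ := exists_forall_deriv_le_of_osc_le
    (M := 2 * (M * (M + M * M) + (M + M * M) * M)) (κ := 2 * η ^ 2) (by positivity) (by positivity)
  refine ⟨κ, hκ, fun a b x₁ x₂ x₃ u h hab hV hdrop => ?_⟩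
  have hle : a ≤ b := by linarith
  have hx3 : ∀ t ∈ Icc a b, |x₃ t| ≤ η := by
    have := H₂ a b _ _ hab h.hasDerivWithinAt_energy (fun t ht s hs => ?_) (fun t ht s hs => ?_)
    · intro t ht
      have h1 := this t ht
      rw [abs_mul, abs_of_nonneg (sq_nonneg (x₃ t)), abs_neg, abs_two] at h1
      exact abs_le_of_sq_le_sq (by linarith) hη.le
    · rw [← mul_sub, abs_mul, abs_neg, abs_two, pow_two, pow_two]
      have := abs_mul_sub_mul_le (h.bound₃ t ht) (h.bound₃ s hs) (h.lip₃ hM.le ht hs)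
        (h.lip₃ hM.le ht hs)
      linarith
    · have e1 := h.antitoneOn_energy ⟨le_rfl, hle⟩ ht ht.1
      have e2 := h.antitoneOn_energy ht ⟨hle, le_rfl⟩ ht.2
      have e3 := h.antitoneOn_energy ⟨le_rfl, hle⟩ hs hs.1
      have e4 := h.antitoneOn_energy hs ⟨hle, le_rfl⟩ hs.2
      simp only at e1 e2 e3 e4
      rw [abs_le]
      constructor <;> linarith
  have hd3 := H₁ a b _ _ hab h.deriv₃ (fun t ht s hs => by
      have e1 := abs_mul_sub_mul_le (h.bound_u t ht) (h.bound₂ s hs) (h.lip_u t ht s hs)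
        (h.lip₂ hM.le ht hs)
      have e2 := h.lip₃ hM.le ht hs
      rw [show -x₃ t - u t * x₂ t - (-x₃ s - u s * x₂ s) =
        -(x₃ t - x₃ s) - (u t * x₂ t - u s * x₂ s) by ring]
      refine (abs_sub _ _).trans ?_
      rw [abs_neg]
      simp only [M₃]
      linarith) (fun t ht s hs => by
      refine (abs_sub _ _).trans ?_
      linarith [hx3 t ht, hx3 s hs])
  intro t ht
  have h3 := hx3 t ht
  have h2 : ε / 2 ≤ |x₂ t| := by
    have h4 : x₃ t ^ 2 ≤ (ε / 2) ^ 2 := by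
      rw [← sq_abs]
      exact pow_le_pow_left₀ (abs_nonneg _) (h3.trans hη4) 2
    refine abs_le_of_sq_le_sq' (?_ : (ε / 2) ^ 2 ≤ |x₂ t| ^ 2) (abs_nonneg _) |>.2
    rw [sq_abs]
    nlinarith [hV t ht]
  refine ⟨h3.trans hη3, ?_, h2⟩
  have h5 : |u t| * |x₂ t| ≤ ν * ε / 2 := by
    rw [← abs_mul, show u t * x₂ t = -(-x₃ t - u t * x₂ t) - x₃ t by ring]
    refine (abs_sub _ _).trans ?_
    rw [abs_neg]
    linarith [hd3 t ht]
  have h6 : |u t| * (ε / 2) ≤ ν * (ε / 2) := by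
    have := mul_le_mul_of_nonneg_left h2 (abs_nonneg (u t))
    linarith
  exact le_of_mul_le_mul_right h6 (by positivity)

end BoundedTraj

/-- Persistency of excitation forces the energy to fall below `ε ^ 2` within a uniform time. -/
theorem exists_time_energy_lt {h : ℝ → EuclideanSpace ℝ (Fin 2) → ℝ} {ρ : ℝ → ℝ}
    (h_smooth : ContDiff ℝ 2 (uncurry h)) (hρ : MonotoneOn ρ (Ici 0))
    (h_first : ∀ (i : Fin 3) (t : ℝ) (z : EuclideanSpace ℝ (Fin 2)),
      |partialDeriv i (uncurry h) (t, z)| ≤ ρ ‖z‖)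
    (h_second : ∀ (i j : Fin 3) (t : ℝ) (z : EuclideanSpace ℝ (Fin 2)),
      |partialDeriv i (partialDeriv j (uncurry h)) (t, z)| ≤ ρ ‖z‖)
    (h_pe : UDeltaPE (psi h) (fun x₂ : ℝ => x₂)) {M ε : ℝ} (hM : 0 < M) (hε : 0 < ε)
    (r : ℝ) :
    ∃ T : ℝ, 0 < T ∧ ∀ (a : ℝ) (x₁ x₂ x₃ u : ℝ → ℝ), BoundedTraj M a (a + T) x₁ x₂ x₃ u →
      (∀ t ∈ Icc a (a + T), u t = -x₁ t + h t !₂[x₂ t, x₃ t]) → x₂ a ^ 2 + x₃ a ^ 2 ≤ r ^ 2 →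
      x₂ (a + T) ^ 2 + x₃ (a + T) ^ 2 < ε ^ 2 := by
  wlog hr : 0 ≤ r generalizing r
  · simpa using this (-r) (by linarith)
  have hK : IsCompact {z : ℝ | ε / 2 ≤ |z| ∧ |z| ≤ r} := by
    refine (isCompact_Icc (a := -r) (b := r)).of_isClosed_subset ?_ fun z hz => abs_le.1 hz.2
    exact (isClosed_le continuous_const continuous_abs).inter
      (isClosed_le continuous_abs continuous_const)
  obtain ⟨l, hl, μ, hμ, hpe⟩ := h_pe.exists_forall_isCompact hK
    (by simp only [mem_ofPred_eq, abs_zero]; intro h; linarith [h.1])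
  have hl0 : 0 < l := by linarith
  have hρ0 : 0 ≤ ρ r := by
    have h1 := (abs_nonneg _).trans (h_first 0 0 0)
    rw [norm_zero] at h1
    exact h1.trans (hρ (mem_Ici.2 le_rfl) hr hr)
  let D : ℝ := 3 * ρ r
  have hD : 0 ≤ D := by positivity
  obtain ⟨κ₂, hκ₂, Hψ⟩ := exists_forall_deriv_le_of_osc_le (M := ρ r) (κ := μ / (2 * l))
    hρ0 (by positivity)
  -- The oscillation of `h(·, (x₂(s), 0))` in units of `ν`: `2` for `u` at two times, `l` for the
  -- drift of `x₁`, and twice the error of replacing `(x₂(t), x₃(t))` by `(x₂(s), 0)`.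
  let C : ℝ := 2 + l + 2 * (D * (M * l + 1))
  have hC : 0 < C := by positivity
  obtain ⟨κ, hκ, Hκ⟩ := BoundedTraj.exists_small_of_energy_drop_le hM hε
    (ν := κ₂ / C) (by positivity)
  set ν : ℝ := κ₂ / C with hνdef
  have hν : 0 < ν := by positivity
  have hνC : C * ν = κ₂ := by rw [hνdef]; field_simp
  -- As `V` lies between `0` and `r²`, it cannot lose more than `κ` on each of `N > r²/κ` windows.
  obtain ⟨N, hN⟩ := exists_nat_gt (r ^ 2 / κ)
  have hNpos : 0 < N := by
    have : (0 : ℝ) < N := lt_of_le_of_lt (by positivity) hN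
    exact_mod_cast this
  have hNR : (0 : ℝ) < N := by exact_mod_cast hNpos
  refine ⟨N * l, by positivity, fun a x₁ x₂ x₃ u hx hu ha => ?_⟩
  by_contra! hcon
  have haT : a ≤ a + N * l := by linarith [mul_pos hNR hl0]
  have hVε : ∀ t ∈ Icc a (a + N * l), ε ^ 2 ≤ x₂ t ^ 2 + x₃ t ^ 2 := fun t ht =>
    hcon.trans (hx.antitoneOn_energy ht ⟨haT, le_rfl⟩ ht.2)
  have hVr : ∀ t ∈ Icc a (a + N * l), x₂ t ^ 2 + x₃ t ^ 2 ≤ r ^ 2 := fun t ht =>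
    (hx.antitoneOn_energy ⟨le_rfl, haT⟩ ht ht.1).trans ha
  obtain ⟨k, hk, hdrop⟩ := exists_window_drop_le (V := fun t => x₂ t ^ 2 + x₃ t ^ 2) (a := a)
    (l := l) (κ := κ) hNpos (by
      rw [div_lt_iff₀ hκ] at hN
      exact ha.trans hN.le) (by positivity)
  have hk1 : ((k + 1 : ℕ) : ℝ) ≤ N := by exact_mod_cast hk
  set s : ℝ := a + k * l with hs
  have hse : a + (k + 1 : ℕ) * l = s + l := by rw [hs]; push_cast; ring
  rw [hse] at hdrop
  have has : a ≤ s := by rw [hs]; have : (0 : ℝ) ≤ k * l := by positivity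
                         linarith
  have hsT : s + l ≤ a + N * l := by
    rw [← hse]
    have := mul_le_mul_of_nonneg_right hk1 hl0.le
    linarith
  have hsub : Icc s (s + l) ⊆ Icc a (a + N * l) := Icc_subset_Icc has hsT
  have hx' := hx.mono has hsT
  have hsmall := Hκ s (s + l) x₁ x₂ x₃ u hx' (by linarith) (fun t ht => hVε t (hsub ht)) hdrop
  have hs0 : s ∈ Icc s (s + l) := ⟨le_rfl, by linarith⟩
  have hx2r : ∀ t ∈ Icc s (s + l), |x₂ t| ≤ r := fun t ht =>
    abs_le_of_sq_le_sq (by nlinarith [hVr t (hsub ht), sq_nonneg (x₃ t)]) hr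
  have hzr : ∀ t ∈ Icc s (s + l), ‖(!₂[x₂ t, x₃ t] : EuclideanSpace ℝ (Fin 2))‖ ≤ r := fun t ht =>
    abs_le_of_sq_le_sq' (by rw [norm_vec2_sq]; exact hVr t (hsub ht)) hr |>.2
  have hlen : ∀ t ∈ Icc s (s + l), ∀ t' ∈ Icc s (s + l), |t - t'| ≤ l := fun t ht t' ht' => by
    rw [abs_le]; constructor <;> linarith [ht.1, ht.2, ht'.1, ht'.2]
  have hfreeze : ∀ t ∈ Icc s (s + l),
      |h t !₂[x₂ t, x₃ t] - hZero h t (x₂ s)| ≤ D * (M * l + 1) * ν := by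
    intro t ht
    refine (abs_sub_le_of_partialDeriv_le h_smooth hρ h_first (hzr t ht)
      (by rw [norm_vec2_zero]; exact hx2r s hs0) t t).trans ?_
    have h1 := norm_vec2_sub_le (x₂ t) (x₃ t) (x₂ s) 0
    have h2 : |x₂ t - x₂ s| ≤ ν * M * |t - s| :=
      abs_sub_le_of_hasDerivWithinAt_Icc hx'.deriv₂ (fun q hq => by
        rw [abs_mul]
        gcongr
        exacts [(hsmall q hq).2.1, hx'.bound₃ q hq]) ht hs0
    have h3 : ν * M * |t - s| ≤ ν * M * l := by gcongr; exact hlen t ht s hs0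
    have h4 := (hsmall t ht).1
    rw [sub_self, abs_zero, zero_add, mul_assoc D]
    refine mul_le_mul_of_nonneg_left ?_ hD
    rw [sub_zero] at h1
    linarith
  have hosc : ∀ t ∈ Icc s (s + l), ∀ t' ∈ Icc s (s + l),
      |hZero h t (x₂ s) - hZero h t' (x₂ s)| ≤ κ₂ := by
    intro t ht t' ht'
    have h1 := abs_le.1 (hfreeze t ht)
    have h2 := abs_le.1 (hfreeze t' ht')
    have h3 : |x₁ t - x₁ t'| ≤ ν * |t - t'| :=
      abs_sub_le_of_hasDerivWithinAt_Icc hx'.deriv₁ (fun q hq => (hsmall q hq).2.1) ht ht'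
    have h4 : ν * |t - t'| ≤ ν * l := by gcongr; exact hlen t ht t' ht'
    have h5 := abs_le.1 (h3.trans h4)
    have h6 := abs_le.1 (hsmall t ht).2.1
    have h7 := abs_le.1 (hsmall t' ht').2.1
    have h8 := hu t (hsub ht)
    have h9 := hu t' (hsub ht')
    rw [← hνC]
    simp only [C]
    rw [abs_le]
    constructor <;> linarith
  have hψ := Hψ s (s + l) (fun t => hZero h t (x₂ s)) (fun t => psi h t (x₂ s)) (by linarith)
    (fun t _ => (hasDerivAt_hZero h_smooth t (x₂ s)).hasDerivWithinAt)
    (fun t _ t' _ => (abs_psi_sub_le h_smooth h_second t t' (x₂ s)).trans (by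
      gcongr
      exact hρ (mem_Ici.2 (abs_nonneg _)) hr (hx2r s hs0))) hosc
  -- Excitation makes the integral over the window at least `μ`, while `|ψ| ≤ μ/(2l)` makes it at
  -- most `μ/2`.
  have hint := hpe s (x₂ s) ⟨(hsmall s hs0).2.2, hx2r s hs0⟩
  have hup := intervalIntegral.norm_integral_le_of_norm_le_const (a := s) (b := s + l)
    (C := μ / (2 * l)) (f := fun τ => |psi h τ (x₂ s)|) (fun τ hτ => by
      rw [uIoc_of_le hs0.2] at hτ
      simpa using hψ τ (Ioc_subset_Icc_self hτ))
  rw [add_sub_cancel_left, abs_of_pos hl0, Real.norm_eq_abs] at hup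
  have hfin : μ / (2 * l) * l = μ / 2 := by field_simp
  linarith [le_abs_self (∫ τ in s..(s + l), |psi h τ (x₂ s)|)]

end Windows

/-! ### A priori bounds, stability and attractivity of the closed loop. -/

section ClosedLoop

variable {h : ℝ → EuclideanSpace ℝ (Fin 2) → ℝ} {ρ : ℝ → ℝ}

theorem hasDerivWithinAt_coord {n : ℕ} {y : ℝ → EuclideanSpace ℝ (Fin n)}
    {v : EuclideanSpace ℝ (Fin n)} {s : Set ℝ} {t : ℝ} (hy : HasDerivWithinAt y v s t) (i : Fin n) :
    HasDerivWithinAt (fun t => y t i) (v i) s t :=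
  (EuclideanSpace.proj (𝕜 := ℝ) i).hasFDerivAt.comp_hasDerivWithinAt t hy

theorem contDiff_closedLoop (h_smooth : ContDiff ℝ 2 (uncurry h)) :
    ContDiff ℝ 1 (uncurry (closedLoop h)) := by
  have hh : ContDiff ℝ 1 (uncurry h) := h_smooth.of_le (by norm_num)
  have hc : ∀ i : Fin 3, ContDiff ℝ 1 fun p : ℝ × EuclideanSpace ℝ (Fin 3) => p.2 i := fun i =>
    (EuclideanSpace.proj (𝕜 := ℝ) i).contDiff.comp contDiff_snd
  have hz : ContDiff ℝ 1 fun p : ℝ × EuclideanSpace ℝ (Fin 3) =>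
      (!₂[p.2 1, p.2 2] : EuclideanSpace ℝ (Fin 2)) := by
    rw [contDiff_euclidean]
    intro i
    fin_cases i
    · exact hc 1
    · exact hc 2
  have hu : ContDiff ℝ 1 fun p : ℝ × EuclideanSpace ℝ (Fin 3) => controlU h p.1 p.2 :=
    (hc 0).neg.add (hh.comp (contDiff_fst.prodMk hz))
  rw [contDiff_euclidean]
  intro i
  fin_cases i
  · exact hu
  · exact hu.mul (hc 2)
  · exact (hc 2).neg.sub (hu.mul (hc 1))

theorem energy_le_norm_sq (x : EuclideanSpace ℝ (Fin 3)) : x 1 ^ 2 + x 2 ^ 2 ≤ ‖x‖ ^ 2 := by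
  rw [EuclideanSpace.real_norm_sq_eq, Fin.sum_univ_three]
  nlinarith [sq_nonneg (x 0)]

theorem norm_le_of_energy_le {x : EuclideanSpace ℝ (Fin 3)} {A B : ℝ} (hA : |x 0| ≤ A)
    (hB0 : 0 ≤ B) (hB : x 1 ^ 2 + x 2 ^ 2 ≤ B ^ 2) : ‖x‖ ≤ A + B := by
  have hA0 : 0 ≤ A := (abs_nonneg _).trans hA
  refine abs_le_of_sq_le_sq' ?_ (by positivity) |>.2
  rw [EuclideanSpace.real_norm_sq_eq, Fin.sum_univ_three]
  have : x 0 ^ 2 ≤ A ^ 2 := by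
    rw [← sq_abs]
    exact pow_le_pow_left₀ (abs_nonneg _) hA 2
  nlinarith [mul_nonneg hA0 hB0]

theorem rho_nonneg (h_first : ∀ (i : Fin 3) (t : ℝ) (z : EuclideanSpace ℝ (Fin 2)),
      |partialDeriv i (uncurry h) (t, z)| ≤ ρ ‖z‖) {s : ℝ} (hs : 0 ≤ s) : 0 ≤ ρ s := by
  have := (abs_nonneg _).trans (h_first 0 0 !₂[s, 0])
  rwa [norm_vec2_zero, abs_of_nonneg hs] at this

/-- A priori bounds, valid for the closed loop with its velocity scaled by any `c ≥ 0`. -/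
theorem state_bound (h_smooth : ContDiff ℝ 2 (uncurry h)) (h_zero : ∀ t : ℝ, h t 0 = 0)
    (hρ : MonotoneOn ρ (Ici 0))
    (h_first : ∀ (i : Fin 3) (t : ℝ) (z : EuclideanSpace ℝ (Fin 2)),
      |partialDeriv i (uncurry h) (t, z)| ≤ ρ ‖z‖)
    {a b r : ℝ} {c : ℝ → ℝ} {y : ℝ → EuclideanSpace ℝ (Fin 3)} (hc : ∀ t, 0 ≤ c t)
    (hy : ∀ t ∈ Icc a b, HasDerivWithinAt y (c t • closedLoop h t (y t)) (Icc a b) t)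
    (hr : ‖y a‖ ≤ r) {t : ℝ} (ht : t ∈ Icc a b) :
    y t 1 ^ 2 + y t 2 ^ 2 ≤ r ^ 2 ∧ |y t 0| ≤ r + 3 * ρ r * r := by
  have hr0 : 0 ≤ r := (norm_nonneg _).trans hr
  have hρ0 : 0 ≤ ρ r := rho_nonneg h_first hr0
  have d0 : ∀ t ∈ Icc a b, HasDerivWithinAt (fun t => y t 0) (c t * controlU h t (y t))
    (Icc a b) t := fun t ht => hasDerivWithinAt_coord (hy t ht) 0
  have d1 : ∀ t ∈ Icc a b, HasDerivWithinAt (fun t => y t 1)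
    (c t * (controlU h t (y t) * y t 2)) (Icc a b) t := fun t ht =>
      hasDerivWithinAt_coord (hy t ht) 1
  have d2 : ∀ t ∈ Icc a b, HasDerivWithinAt (fun t => y t 2)
    (c t * (-y t 2 - controlU h t (y t) * y t 1)) (Icc a b) t := fun t ht =>
      hasDerivWithinAt_coord (hy t ht) 2
  have hV : AntitoneOn (fun t => y t 1 ^ 2 + y t 2 ^ 2) (Icc a b) := by
    refine antitoneOn_Icc_of_hasDerivWithinAt (g' := fun t => -2 * (c t * y t 2 ^ 2))
      (fun t ht => (((d1 t ht).pow 2).add ((d2 t ht).pow 2)).congr_deriv ?_) fun t _ => ?_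
    · push_cast
      ring
    · nlinarith [mul_nonneg (hc t) (sq_nonneg (y t 2))]
  have hle : ∀ t ∈ Icc a b, y t 1 ^ 2 + y t 2 ^ 2 ≤ r ^ 2 := fun t ht =>
    (hV ⟨le_rfl, ht.1.trans ht.2⟩ ht ht.1).trans
      ((energy_le_norm_sq _).trans (pow_le_pow_left₀ (norm_nonneg _) hr 2))
  have hh : ∀ t ∈ Icc a b, |h t !₂[y t 1, y t 2]| ≤ 3 * ρ r * r := fun t ht => by
    have hz : ‖(!₂[y t 1, y t 2] : EuclideanSpace ℝ (Fin 2))‖ ≤ r :=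
      abs_le_of_sq_le_sq' (by rw [norm_vec2_sq]; exact hle t ht) hr0 |>.2
    exact (abs_le_of_partialDeriv_le h_smooth h_zero hρ h_first hz t).trans (by gcongr)
  have hB : 0 ≤ 3 * ρ r * r := by positivity
  have ha0 := abs_le.1 ((PiLp.norm_apply_le (y a) 0).trans hr)
  refine ⟨hle t ht, abs_le.2 ⟨?_, ?_⟩⟩
  -- Beyond the level `r + 3 ρ(r) r` the term `-x₁` dominates `h`, so the velocity points inward;
  -- the factor `c ≥ 0` preserves its sign. The lower bound is the upper bound for `-x₁`.
  · have := le_of_hasDerivWithinAt_nonpos_above (g := fun t => -y t 0)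
      (B := r + 3 * ρ r * r) (fun t ht => (d0 t ht).neg) (by linarith) (fun t ht hlt => by
        have := abs_le.1 (hh t ht)
        have h2 : 0 ≤ controlU h t (y t) := by simp only [controlU]; linarith
        nlinarith [mul_nonneg (hc t) h2]) t ht
    linarith
  · refine le_of_hasDerivWithinAt_nonpos_above d0 (by linarith) (fun t ht hlt => ?_) t ht
    have := abs_le.1 (hh t ht)
    refine mul_nonpos_of_nonneg_of_nonpos (hc t) ?_
    simp only [controlU]
    linarith

theorem norm_state_le (h_smooth : ContDiff ℝ 2 (uncurry h)) (h_zero : ∀ t : ℝ, h t 0 = 0)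
    (hρ : MonotoneOn ρ (Ici 0))
    (h_first : ∀ (i : Fin 3) (t : ℝ) (z : EuclideanSpace ℝ (Fin 2)),
      |partialDeriv i (uncurry h) (t, z)| ≤ ρ ‖z‖)
    {a b r : ℝ} {c : ℝ → ℝ} {y : ℝ → EuclideanSpace ℝ (Fin 3)} (hc : ∀ t, 0 ≤ c t)
    (hy : ∀ t ∈ Icc a b, HasDerivWithinAt y (c t • closedLoop h t (y t)) (Icc a b) t)
    (hr : ‖y a‖ ≤ r) {t : ℝ} (ht : t ∈ Icc a b) : ‖y t‖ ≤ 2 * r + 3 * r * ρ r := by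
  obtain ⟨h1, h2⟩ := state_bound h_smooth h_zero hρ h_first hc hy hr ht
  have := norm_le_of_energy_le h2 ((norm_nonneg _).trans hr) h1
  linarith

theorem forwardComplete_closedLoop (h_smooth : ContDiff ℝ 2 (uncurry h))
    (h_zero : ∀ t : ℝ, h t 0 = 0) (hρ : MonotoneOn ρ (Ici 0))
    (h_first : ∀ (i : Fin 3) (t : ℝ) (z : EuclideanSpace ℝ (Fin 2)),
      |partialDeriv i (uncurry h) (t, z)| ≤ ρ ‖z‖) : ForwardComplete (closedLoop h) :=
  forwardComplete_of_apriori (contDiff_closedLoop h_smooth) fun _ x₀ =>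
    ⟨2 * ‖x₀‖ + 3 * ‖x₀‖ * ρ ‖x₀‖, fun _ _ _ hc h0 hy _ ht =>
      norm_state_le h_smooth h_zero hρ h_first hc hy (by rw [h0]) ht⟩

theorem IsSolutionOn.hasDerivWithinAt_Icc {E : Type*} [NormedAddCommGroup E] [NormedSpace ℝ E]
    {f : ℝ → E → E} {t₀ : ℝ} {x₀ : E} {x : ℝ → E} (hx : IsSolutionOn f t₀ x₀ (Ici t₀) x)
    {a : ℝ} (ha : t₀ ≤ a) (b t : ℝ) (ht : t ∈ Icc a b) :
    HasDerivWithinAt x (f t (x t)) (Icc a b) t :=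
  (hx.2 t (ha.trans ht.1)).mono fun _ hs => ha.trans hs.1

/-- A nonnegative non-decreasing function on `[0, ∞)` gives rise to a class `K∞` majorant of
`2 s + 3 s ρ(s)`. -/
theorem exists_isClassKInfty_ge (hρ : MonotoneOn ρ (Ici 0)) (hρ0 : ∀ s, 0 ≤ s → 0 ≤ ρ s) :
    ∃ γ : ℝ → ℝ, IsClassKInfty γ ∧ ∀ s, 0 ≤ s → 2 * s + 3 * s * ρ s ≤ γ s := by
  let q : ℝ → ℝ := fun s => ρ (max s 0)
  have hq : Monotone q := fun s t hst =>
    hρ (mem_Ici.2 (le_max_right _ _)) (mem_Ici.2 (le_max_right _ _)) (max_le_max_right 0 hst)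
  have hint : ∀ s t, IntervalIntegrable q volume s t := fun s t =>
    (hq.monotoneOn _).intervalIntegrable
  -- Since `ρ` may jump, it is averaged over `[s, s + 1]`: the average is continuous, still
  -- non-decreasing, and at least the value at the left end.
  let g : ℝ → ℝ := fun s => ∫ τ in s..(s + 1), q τ
  have hg : Continuous g := by
    have : g = fun s => (∫ τ in (0 : ℝ)..(s + 1), q τ) - ∫ τ in (0 : ℝ)..s, q τ := by
      funext s
      exact (intervalIntegral.integral_interval_sub_left (hint _ _) (hint _ _)).symm
    rw [this]
    have hp := intervalIntegral.continuous_primitive hint 0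
    exact (hp.comp (continuous_id.add continuous_const)).sub hp
  have hqg : ∀ s, q s ≤ g s := fun s => by
    have := intervalIntegral.integral_mono_on (a := s) (b := s + 1) (by linarith)
      (intervalIntegrable_const (c := q s)) (hint _ _) fun τ hτ => hq hτ.1
    simpa using this
  have hgm : Monotone g := fun s t hst => by
    have : ∀ s, g s = ∫ τ in (0 : ℝ)..1, q (s + τ) := fun s => by
      rw [intervalIntegral.integral_comp_add_left q s, add_zero]
    rw [this, this]
    refine intervalIntegral.integral_mono_on zero_le_one ?_ ?_ fun τ _ => hq (by linarith)
    · exact (Monotone.monotoneOn (fun _ _ hab => hq (by linarith)) _).intervalIntegrable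
    · exact (Monotone.monotoneOn (fun _ _ hab => hq (by linarith)) _).intervalIntegrable
  have hg0 : ∀ s, 0 ≤ g s := fun s => (hρ0 _ (le_max_right _ _)).trans (hqg s)
  refine ⟨fun s => 2 * s + 3 * s * g s, ⟨?_, ?_, by simp, ?_⟩, fun s hs => ?_⟩
  · exact (by fun_prop : Continuous fun s => 2 * s + 3 * s * g s).continuousOn
  · intro s hs t ht hst
    have hs' : 0 ≤ s := hs
    have := mul_le_mul hst.le (hgm hst.le) (hg0 s) (hs'.trans hst.le)
    simp only
    linarith
  · refine Filter.tendsto_atTop_mono' _ ?_ Filter.tendsto_id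
    filter_upwards [Filter.eventually_ge_atTop 0] with s hs
    have := mul_nonneg hs (hg0 s)
    simp only [id]
    linarith
  · have h1 : q s = ρ s := by simp [q, hs]
    have := mul_le_mul_of_nonneg_left (h1 ▸ hqg s) hs
    linarith

theorem ugs_closedLoop (h_smooth : ContDiff ℝ 2 (uncurry h))
    (h_zero : ∀ t : ℝ, h t 0 = 0) (hρ : MonotoneOn ρ (Ici 0))
    (h_first : ∀ (i : Fin 3) (t : ℝ) (z : EuclideanSpace ℝ (Fin 2)),
      |partialDeriv i (uncurry h) (t, z)| ≤ ρ ‖z‖) : UGS (closedLoop h) := by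
  refine ⟨forwardComplete_closedLoop h_smooth h_zero hρ h_first, ?_⟩
  obtain ⟨γ, hγ, hle⟩ := exists_isClassKInfty_ge hρ fun s hs => rho_nonneg h_first hs
  refine ⟨γ, hγ, fun t₀ x₀ x hx t ht => ?_⟩
  have := norm_state_le h_smooth h_zero hρ h_first (c := fun _ => 1) (fun _ => zero_le_one)
    (fun s hs => by simpa using hx.hasDerivWithinAt_Icc le_rfl t s hs) le_rfl ⟨ht, le_rfl⟩
  rw [hx.1] at this
  exact this.trans (hle _ (norm_nonneg _))

/-- The function `e^t (g(t) - B)` has derivative `e^t (k(t) - B) ≤ 0`. -/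
theorem le_exp_decay {a b B : ℝ} {g k : ℝ → ℝ} (hB : 0 ≤ B) (hab : a ≤ b)
    (hg : ∀ t ∈ Icc a b, HasDerivWithinAt g (-g t + k t) (Icc a b) t)
    (hk : ∀ t ∈ Icc a b, k t ≤ B) : g b ≤ B + Real.exp (a - b) * |g a| := by
  have hanti := antitoneOn_Icc_of_hasDerivWithinAt
    (fun t ht => (Real.hasDerivAt_exp t).hasDerivWithinAt.mul ((hg t ht).sub_const B))
    (fun t ht => by
      have := mul_nonneg (Real.exp_pos t).le (sub_nonneg.2 (hk t ht))
      linarith)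
  have h1 := hanti ⟨le_rfl, hab⟩ ⟨hab, le_rfl⟩ hab
  simp only [Pi.mul_apply] at h1
  have h2 : g b - B ≤ Real.exp (a - b) * (g a - B) := by
    rw [Real.exp_sub, div_mul_eq_mul_div, le_div_iff₀ (Real.exp_pos b)]
    linarith
  have h3 : Real.exp (a - b) * (g a - B) ≤ Real.exp (a - b) * |g a| := by
    gcongr
    linarith [le_abs_self (g a)]
  linarith

theorem abs_le_exp_decay {a b B : ℝ} {g k : ℝ → ℝ} (hB : 0 ≤ B) (hab : a ≤ b)
    (hg : ∀ t ∈ Icc a b, HasDerivWithinAt g (-g t + k t) (Icc a b) t)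
    (hk : ∀ t ∈ Icc a b, |k t| ≤ B) : |g b| ≤ B + Real.exp (a - b) * |g a| := by
  refine abs_le'.2 ⟨le_exp_decay hB hab hg fun t ht => (abs_le.1 (hk t ht)).2, ?_⟩
  rw [← abs_neg (g a)]
  refine le_exp_decay (g := fun t => -g t) (k := fun t => -k t) hB hab
    (fun t ht => ((hg t ht).neg).congr_deriv (by ring)) fun t ht => ?_
  linarith [(abs_le.1 (hk t ht)).1]

/-- Solutions starting in a fixed ball are trajectories with uniform bounds. -/
theorem exists_boundedTraj (h_smooth : ContDiff ℝ 2 (uncurry h)) (h_zero : ∀ t : ℝ, h t 0 = 0)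
    (hρ : MonotoneOn ρ (Ici 0))
    (h_first : ∀ (i : Fin 3) (t : ℝ) (z : EuclideanSpace ℝ (Fin 2)),
      |partialDeriv i (uncurry h) (t, z)| ≤ ρ ‖z‖) {r : ℝ} (hr : 0 ≤ r) :
    ∃ M : ℝ, 0 < M ∧ ∀ (a b : ℝ) (y : ℝ → EuclideanSpace ℝ (Fin 3)), ‖y a‖ ≤ r →
      (∀ t ∈ Icc a b, HasDerivWithinAt y (closedLoop h t (y t)) (Icc a b) t) →
      BoundedTraj M a b (fun t => y t 0) (fun t => y t 1) (fun t => y t 2)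
        fun t => controlU h t (y t) := by
  have hρ0 : 0 ≤ ρ r := rho_nonneg h_first hr
  let D : ℝ := 3 * ρ r
  have hD : 0 ≤ D := by positivity
  -- `U` bounds `|u| ≤ |x₁| + |h|`. `Λ` is a Lipschitz constant of `u` along the trajectory: `U`
  -- from `x₁`, the rest from `h` through `t`, `x₂` and `x₃`.
  let U : ℝ := r + D * r + D * r
  have hU : 0 ≤ U := by positivity
  let Λ : ℝ := U + D * (1 + (U * r + (r + U * r)))
  have hΛ : 0 ≤ Λ := by positivity
  refine ⟨r + U + Λ + 1, by positivity, fun a b y hya hy => ?_⟩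
  have hst : ∀ t ∈ Icc a b, y t 1 ^ 2 + y t 2 ^ 2 ≤ r ^ 2 ∧ |y t 0| ≤ r + D * r := fun t ht =>
    state_bound h_smooth h_zero hρ h_first (c := fun _ => 1) (fun _ => zero_le_one)
      (fun s hs => by simpa using hy s hs) hya ht
  have d0 : ∀ t ∈ Icc a b, HasDerivWithinAt (fun t => y t 0) (controlU h t (y t))
    (Icc a b) t := fun t ht => hasDerivWithinAt_coord (hy t ht) 0
  have d1 : ∀ t ∈ Icc a b, HasDerivWithinAt (fun t => y t 1)
    (controlU h t (y t) * y t 2) (Icc a b) t := fun t ht => hasDerivWithinAt_coord (hy t ht) 1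
  have d2 : ∀ t ∈ Icc a b, HasDerivWithinAt (fun t => y t 2)
    (-y t 2 - controlU h t (y t) * y t 1) (Icc a b) t := fun t ht =>
      hasDerivWithinAt_coord (hy t ht) 2
  have b1 : ∀ t ∈ Icc a b, |y t 1| ≤ r := fun t ht =>
    abs_le_of_sq_le_sq (by nlinarith [(hst t ht).1, sq_nonneg (y t 2)]) hr
  have b2 : ∀ t ∈ Icc a b, |y t 2| ≤ r := fun t ht =>
    abs_le_of_sq_le_sq (by nlinarith [(hst t ht).1, sq_nonneg (y t 1)]) hr
  have bz : ∀ t ∈ Icc a b, ‖(!₂[y t 1, y t 2] : EuclideanSpace ℝ (Fin 2))‖ ≤ r := fun t ht =>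
    abs_le_of_sq_le_sq' (by rw [norm_vec2_sq]; exact (hst t ht).1) hr |>.2
  have bu : ∀ t ∈ Icc a b, |controlU h t (y t)| ≤ U := fun t ht => by
    have h1 := abs_le_of_partialDeriv_le h_smooth h_zero hρ h_first (bz t ht) t
    have h2 : D * ‖(!₂[y t 1, y t 2] : EuclideanSpace ℝ (Fin 2))‖ ≤ D * r := by
      gcongr; exact bz t ht
    refine (abs_add_le _ _).trans ?_
    rw [abs_neg]
    simp only [U, D] at *
    linarith [(hst t ht).2]
  have l1 : ∀ t ∈ Icc a b, ∀ s ∈ Icc a b, |y t 1 - y s 1| ≤ U * r * |t - s| := fun t ht s hs =>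
    abs_sub_le_of_hasDerivWithinAt_Icc d1 (fun q hq => by
      rw [abs_mul]
      gcongr
      exacts [bu q hq, b2 q hq]) ht hs
  have l2 : ∀ t ∈ Icc a b, ∀ s ∈ Icc a b, |y t 2 - y s 2| ≤ (r + U * r) * |t - s| :=
    fun t ht s hs => abs_sub_le_of_hasDerivWithinAt_Icc d2 (fun q hq => by
      refine (abs_sub _ _).trans ?_
      rw [abs_neg, abs_mul]
      gcongr
      exacts [b2 q hq, bu q hq, b1 q hq]) ht hs
  have lu : ∀ t ∈ Icc a b, ∀ s ∈ Icc a b,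
      |controlU h t (y t) - controlU h s (y s)| ≤ Λ * |t - s| := by
    intro t ht s hs
    have e0 : |y t 0 - y s 0| ≤ U * |t - s| :=
      abs_sub_le_of_hasDerivWithinAt_Icc d0 bu ht hs
    have e1 := abs_sub_le_of_partialDeriv_le h_smooth hρ h_first (bz t ht) (bz s hs) t s
    have e2 := norm_vec2_sub_le (y t 1) (y t 2) (y s 1) (y s 2)
    have e3 : D * (|t - s| + ‖(!₂[y t 1, y t 2] : EuclideanSpace ℝ (Fin 2)) - !₂[y s 1, y s 2]‖) ≤
        D * (|t - s| + (U * r * |t - s| + (r + U * r) * |t - s|)) := by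
      gcongr
      linarith [l1 t ht s hs, l2 t ht s hs]
    rw [show controlU h t (y t) - controlU h s (y s) =
      (h t !₂[y t 1, y t 2] - h s !₂[y s 1, y s 2]) - (y t 0 - y s 0) by
        simp only [controlU]; ring]
    refine (abs_sub _ _).trans ?_
    have e4 : Λ * |t - s| = U * |t - s| +
      D * (|t - s| + (U * r * |t - s| + (r + U * r) * |t - s|)) := by simp only [Λ]; ring
    rw [e4]
    linarith [e1.trans e3]
  exact
    { deriv₁ := d0
      deriv₂ := d1
      deriv₃ := d2
      bound₂ := fun t ht => (b1 t ht).trans (by linarith)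
      bound₃ := fun t ht => (b2 t ht).trans (by linarith)
      bound_u := fun t ht => (bu t ht).trans (by linarith)
      lip_u := fun t ht s hs => (lu t ht s hs).trans (by gcongr; linarith) }

theorem uga_closedLoop (h_smooth : ContDiff ℝ 2 (uncurry h))
    (h_zero : ∀ t : ℝ, h t 0 = 0) (hρ : MonotoneOn ρ (Ici 0))
    (h_first : ∀ (i : Fin 3) (t : ℝ) (z : EuclideanSpace ℝ (Fin 2)),
      |partialDeriv i (uncurry h) (t, z)| ≤ ρ ‖z‖)
    (h_second : ∀ (i j : Fin 3) (t : ℝ) (z : EuclideanSpace ℝ (Fin 2)),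
      |partialDeriv i (partialDeriv j (uncurry h)) (t, z)| ≤ ρ ‖z‖)
    (h_pe : UDeltaPE (psi h) (fun x₂ : ℝ => x₂)) : UGA (closedLoop h) := by
  refine ⟨forwardComplete_closedLoop h_smooth h_zero hρ h_first, fun r hr σ hσ => ?_⟩
  have hρ0 : 0 ≤ ρ r := rho_nonneg h_first hr.le
  let D : ℝ := 3 * ρ r
  have hD : 0 ≤ D := by positivity
  -- The final budget is `3σ/4`: `|x₂₃| ≤ ε ≤ σ/4`, the input satisfies `|h| ≤ D ε ≤ σ/4`, and the
  -- transient of `x₁` gets another `σ/4`.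
  let ε : ℝ := min (σ / 4) (σ / (4 * (D + 1)))
  have hε : 0 < ε := lt_min (by positivity) (by positivity)
  have hε1 : ε ≤ σ / 4 := min_le_left _ _
  have hε2 : D * ε ≤ σ / 4 := by
    have h1 : ε ≤ σ / (4 * (D + 1)) := min_le_right _ _
    rw [le_div_iff₀ (by positivity)] at h1
    linarith
  obtain ⟨M, hM, htraj⟩ := exists_boundedTraj h_smooth h_zero hρ h_first hr.le
  obtain ⟨T₁, hT₁, hlt⟩ := exists_time_energy_lt h_smooth hρ h_first h_second h_pe hM hε r
  let R : ℝ := r + D * r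
  have hR : 0 < R := by positivity
  -- By `e^{T₂} ≥ T₂`, this waiting time brings the transient `e^{-T₂} R` below `σ/4`.
  let T₂ : ℝ := R / (σ / 4)
  have hT₂ : 0 < T₂ := by positivity
  refine ⟨T₁ + T₂, by positivity, fun t₀ x₀ x hx hx₀ t ht => ?_⟩
  have hxr : ‖x t₀‖ ≤ r := by rw [hx.1]; exact hx₀
  have hst : ∀ s, t₀ ≤ s → x s 1 ^ 2 + x s 2 ^ 2 ≤ r ^ 2 ∧ |x s 0| ≤ R := fun s hs =>
    state_bound h_smooth h_zero hρ h_first (c := fun _ => 1) (fun _ => zero_le_one)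
      (fun q hq => by simpa using hx.hasDerivWithinAt_Icc le_rfl s q hq) hxr ⟨hs, le_rfl⟩
  have hs0 : x t₀ 1 ^ 2 + x t₀ 2 ^ 2 ≤ r ^ 2 := (hst t₀ le_rfl).1
  have hV1 := hlt t₀ _ _ _ _ (htraj t₀ (t₀ + T₁) x hxr (hx.hasDerivWithinAt_Icc le_rfl _))
    (fun _ _ => rfl) hs0
  have hV : ∀ s, t₀ + T₁ ≤ s → x s 1 ^ 2 + x s 2 ^ 2 ≤ ε ^ 2 := fun s hs =>
    ((htraj t₀ s x hxr (hx.hasDerivWithinAt_Icc le_rfl _)).antitoneOn_energy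
      ⟨by linarith, hs⟩ ⟨by linarith, le_rfl⟩ hs).trans hV1.le
  have hh : ∀ s, t₀ + T₁ ≤ s → |h s !₂[x s 1, x s 2]| ≤ σ / 4 := fun s hs => by
    have h1 : ‖(!₂[x s 1, x s 2] : EuclideanSpace ℝ (Fin 2))‖ ≤ r :=
      abs_le_of_sq_le_sq' (by rw [norm_vec2_sq]; exact (hst s (by linarith)).1) hr.le |>.2
    have h2 : ‖(!₂[x s 1, x s 2] : EuclideanSpace ℝ (Fin 2))‖ ≤ ε :=
      abs_le_of_sq_le_sq' (by rw [norm_vec2_sq]; exact hV s hs) hε.le |>.2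
    refine (abs_le_of_partialDeriv_le h_smooth h_zero hρ h_first h1 s).trans (le_trans ?_ hε2)
    exact mul_le_mul_of_nonneg_left h2 hD
  have hx1 := abs_le_exp_decay (a := t₀ + T₁) (b := t) (g := fun s => x s 0)
    (k := fun s => h s !₂[x s 1, x s 2]) (by positivity : 0 ≤ σ / 4) (by linarith)
    (fun s hs => hasDerivWithinAt_coord
      (hx.hasDerivWithinAt_Icc (by linarith) t s hs) 0) (fun s hs => hh s hs.1)
  have hexp : Real.exp (t₀ + T₁ - t) * R ≤ σ / 4 := by
    have h1 : Real.exp (t₀ + T₁ - t) ≤ Real.exp (-T₂) := Real.exp_le_exp.2 (by linarith)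
    have h2 : Real.exp (-T₂) * R ≤ σ / 4 := by
      rw [Real.exp_neg, inv_mul_le_iff₀ (Real.exp_pos _)]
      have h3 := Real.add_one_le_exp T₂
      have h4 : T₂ * (σ / 4) = R := by simp only [T₂]; field_simp
      nlinarith
    exact (mul_le_mul_of_nonneg_right h1 hR.le).trans h2
  have hx0 : |x t 0| ≤ σ / 4 + σ / 4 := by
    have h1 := mul_le_mul_of_nonneg_left (hst (t₀ + T₁) (by linarith)).2
      (Real.exp_pos (t₀ + T₁ - t)).le
    simp only at hx1
    linarith
  have := norm_le_of_energy_le hx0 hε.le (hV t (by linarith))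
  linarith

end ClosedLoop

end ChainedSystem

theorem proposition1
    (h : ℝ → EuclideanSpace ℝ (Fin 2) → ℝ)
    (h_smooth : ContDiff ℝ 2 (Function.uncurry h))
    (h_zero : ∀ t : ℝ, h t 0 = 0)
    (ρ : ℝ → ℝ) (hρ : MonotoneOn ρ (Set.Ici 0))
    (h_first : ∀ (i : Fin 3) (t : ℝ) (z : EuclideanSpace ℝ (Fin 2)),
      |ChainedSystem.partialDeriv i (Function.uncurry h) (t, z)| ≤ ρ ‖z‖)
    (h_second : ∀ (i j : Fin 3) (t : ℝ) (z : EuclideanSpace ℝ (Fin 2)),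
      |ChainedSystem.partialDeriv i
        (ChainedSystem.partialDeriv j (Function.uncurry h)) (t, z)| ≤ ρ ‖z‖)
    (h_pe : ChainedSystem.UDeltaPE (ChainedSystem.psi h) (fun x₂ : ℝ => x₂)) :
    ChainedSystem.UGAS (ChainedSystem.closedLoop h) :=
  ⟨ChainedSystem.ugs_closedLoop h_smooth h_zero hρ h_first,
    ChainedSystem.uga_closedLoop h_smooth h_zero hρ h_first h_second h_pe⟩
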